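/- Let $G=(V,E)$ be a sorted directed acyclic graph on $V=\{1,\dots,d\}$ (every edge $(i,j)\in E$ satisfies $i<j$), let $\mathrm{PA}(i)=\{j : (j,i)\in E\}$ be the set of parents of $i$, and for $x\in\mathbb{R}^d$ write $x_A=(x_j)_{j\in A}$. A Borel probability measure $\mu$ on $\mathbb{R}^d$ is called *$G$-compatible* if there are a random vector $X=(X_1,\dots,X_d)\sim\mu$, measurable functions $f_i:\mathbb{R}^{|\mathrm{PA}(i)|}\times\mathbb{R}\to\mathbb{R}$ and mutually independent real random variables $U_1,\dots,U_d$ such that $X_i=f_i(X_{\mathrm{PA}(i)},U_i)$ almost surely for $i=1,\dots,d$. A coupling $\pi$ of two $G$-compatible measures $\mu,\nu$ is called *$G$-causal* if there are $(X,X')\sim\pi$, measurable functions $g_1,\dots,g_d$ and real random variables $U_1,\dots,U_d$ such that $X,U_1,\dots,U_d$ are mutually independent and $X'_i=g_i(X_i,X_{\mathrm{PA}(i)},X'_{\mathrm{PA}(i)},U_i)$ almost surely for $i=1,\dots,d$. It is called *$G$-bicausal* if moreover the law of $(X',X)$ is $G$-causal. Let $\Pi_G^{\mathrm{bc}}(\mu,\nu)$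 be the set of $G$-bicausal couplings of $\mu$ and $\nu$, and let $$W_G(\mu,\nu)=\inf_{\pi\in\Pi_G^{\mathrm{bc}}(\mu,\nu)}\int_{\mathbb{R}^d\times\mathbb{R}^d}\|x-x'\|\,\pi(dx,dx'),$$ where $\|\cdot\|$ is the Euclidean norm. **Theorem.** For every $d$ and every compact set $K\subseteq\mathbb{R}^d$ there is a constant $C>0$, depending only on $d$ and $K$, such that for every sorted DAG $G$ on $\{1,\dots,d\}$ and all $G$-compatible probability measures $\mu,\nu$ on $\mathbb{R}^d$ that are supported in $K$ (that is, $\mu(\mathbb{R}^d\setminus K)=\nu(\mathbb{R}^d\setminus K)=0$), $$W_G(\mu,\nu)\le C\sqrt{\tfrac12\,\mathrm{KL}(\mu\,\|\,\nu)},$$ where $\mathrm{KL}(\mu\,\|\,\nu)=\int\log\frac{d\mu}{d\nu}\,d\mu\in[0,\infty]$ is the Kullback-Leibler divergence, equal to $+\infty$ if $\mu$ is not absolutely continuous with respect to $\nu$. -/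

import Mathlib

open MeasureTheory ProbabilityTheory InformationTheory

open scoped ENNReal

noncomputable section

/-- A directed graph on `{1, …, d}` (here `Fin d`) is sorted if every edge `(i, j)` has `i < j`.
A sorted graph is automatically acyclic. -/
def IsSortedDAG {d : ℕ} (G : Digraph (Fin d)) : Prop :=
  ∀ i j, G.Adj i j → i < j

/-- The set of parents of the vertex `i`, as a type. -/
abbrev Parents {d : ℕ} (G : Digraph (Fin d)) (i : Fin d) : Type :=
  {j : Fin d // G.Adj j i}

/-- The slice `x_{PA(i)}` of a vector `x`. -/
def paSlice {d : ℕ} (G : Digraph (Fin d)) (i : Fin d) (x : EuclideanSpace ℝ (Fin d)) :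
    Parents G i → ℝ :=
  fun j => x j.1

/-- `μ` is `G`-compatible: it is the law of a random vector `X` with
`X i = f i (X_{PA(i)}, U i)` for measurable `f i` and mutually independent noises `U i`. -/
def IsGCompatible {d : ℕ} (G : Digraph (Fin d)) (μ : Measure (EuclideanSpace ℝ (Fin d))) : Prop :=
  ∃ (Ω : Type) (_ : MeasurableSpace Ω) (P : Measure Ω) (_ : IsProbabilityMeasure P)
    (X : Ω → EuclideanSpace ℝ (Fin d)) (U : Fin d → Ω → ℝ)
    (f : (i : Fin d) → (Parents G i → ℝ) × ℝ → ℝ),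
    Measurable X ∧ (∀ i, Measurable (U i)) ∧ (∀ i, Measurable (f i)) ∧
    P.map X = μ ∧
    iIndepFun U P ∧
    ∀ i, ∀ᵐ ω ∂P, X ω i = f i (paSlice G i (X ω), U i ω)

/-- `π` is `G`-causal: it is the law of a pair `(X, X')` with
`X' i = g i (X i, X_{PA(i)}, X'_{PA(i)}, U i)` for measurable `g i` and noises `U i` such that
`X, U 1, …, U d` are mutually independent. -/
def IsGCausal {d : ℕ} (G : Digraph (Fin d))
    (π : Measure (EuclideanSpace ℝ (Fin d) × EuclideanSpace ℝ (Fin d))) : Prop :=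
  ∃ (Ω : Type) (_ : MeasurableSpace Ω) (P : Measure Ω) (_ : IsProbabilityMeasure P)
    (X X' : Ω → EuclideanSpace ℝ (Fin d)) (U : Fin d → Ω → ℝ)
    (g : (i : Fin d) → ℝ × (Parents G i → ℝ) × (Parents G i → ℝ) × ℝ → ℝ),
    Measurable X ∧ Measurable X' ∧ (∀ i, Measurable (U i)) ∧ (∀ i, Measurable (g i)) ∧
    P.map (fun ω => (X ω, X' ω)) = π ∧
    iIndepFun U P ∧ IndepFun X (fun ω i => U i ω) P ∧
    ∀ i, ∀ᵐ ω ∂P,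
      X' ω i = g i (X ω i, paSlice G i (X ω), paSlice G i (X' ω), U i ω)

/-- The set of `G`-bicausal couplings of `μ` and `ν`: both the law of `(X, X')` and the law of
the swapped pair `(X', X)` are `G`-causal. -/
def bicausalCouplings {d : ℕ} (G : Digraph (Fin d)) (μ ν : Measure (EuclideanSpace ℝ (Fin d))) :
    Set (Measure (EuclideanSpace ℝ (Fin d) × EuclideanSpace ℝ (Fin d))) :=
  {π | π.map Prod.fst = μ ∧ π.map Prod.snd = ν ∧
    IsGCausal G π ∧ IsGCausal G (π.map Prod.swap)}

/-- The `G`-causal Wasserstein distance, with values in `[0, ∞]`: the infimum over `G`-bicausal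
couplings `π` of `∫ ‖x - x'‖ dπ` (Euclidean norm). -/
def causalWasserstein {d : ℕ} (G : Digraph (Fin d))
    (μ ν : Measure (EuclideanSpace ℝ (Fin d))) : ℝ≥0∞ :=
  ⨅ π ∈ bicausalCouplings G μ ν, ∫⁻ p, ‖p.1 - p.2‖ₑ ∂π

end

/-! A bicausal coupling can be built vertex by vertex. If `μ` and `ν` have transition kernels `M i`
and `M' i` given the parents, then at vertex `i`, given parent values `(y, y')`, draw the pair of
new coordinates from any coupling of `M i y` and `M' i y'`. Since its first marginal depends on `y`
alone and its second on `y'` alone, the resulting law is bicausal with marginals `μ` and `ν`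
(`exists_bicausal_isSequential`).

Choose these couplings maximal, so that the coordinates differ with probability at most the total
variation distance of the kernels (`exists_kernel_maximal_coupling`). On `K` the cost is at most the
diameter times the probability that `X ≠ X'`. If `X ≠ X'`, look at the first coordinate that
differs: sortedness makes its parents agree, so the probability is at most the sum over `i` of the
`μ`-mean distance between `M i y` and `M' i y` at a common `y`.

That distance is attained on a jointly measurable set `A`. Integrating `M i` over `A` against `μ`
gives the `μ`-probability of an event, and likewise for `M' i` and `ν`. Two changes of measure
between `μ` and `ν`, each costing `2 √KL` by a Pinsker type bound, therefore control the mean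
distance (`lintegral_le_klDiv_of_isSequential`). -/

/-! ### Triangular recursions and their solutions -/

section Recursions

variable {d : ℕ} {S S' N : Type*}

/-- Keep the coordinates with index less than `k` and set the others to `0`. -/
def trunc [Zero S] (k : ℕ) (z : Fin d → S) : Fin d → S :=
  fun j => if j.1 < k then z j else 0

lemma trunc_zero [Zero S] (z : Fin d → S) : trunc 0 z = 0 := by
  ext j; simp [trunc]

lemma trunc_of_le [Zero S] {k : ℕ} (hk : d ≤ k) (z : Fin d → S) : trunc k z = z := by
  ext j; simp [trunc, j.2.trans_le hk]

lemma trunc_succ [Zero S] {k : ℕ} (hk : k < d) (z : Fin d → S) :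
    trunc (k + 1) z = Function.update (trunc k z) ⟨k, hk⟩ (z ⟨k, hk⟩) := by
  ext j
  by_cases h : j = ⟨k, hk⟩
  · subst h; simp [trunc]
  · have : j.1 ≠ k := fun h' => h (Fin.ext h')
    simp only [trunc, Function.update_of_ne h]
    congr 1
    simp only [eq_iff_iff]; omega

lemma comp_trunc [Zero S] [Zero S'] {φ : S → S'} (h0 : φ 0 = 0) (k : ℕ) (z : Fin d → S) :
    (fun j => φ (trunc k z j)) = trunc k (fun j => φ (z j)) := by
  ext j
  by_cases h : j.1 < k <;> simp [trunc, h, h0]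

/-- The first `k` steps of the recursion `z i = h i z (n i)`. -/
def solveRec [Zero S] (h : Fin d → (Fin d → S) → N → S) (n : Fin d → N) : ℕ → Fin d → S
  | 0 => 0
  | k + 1 => if hk : k < d then
      Function.update (solveRec h n k) ⟨k, hk⟩ (h ⟨k, hk⟩ (solveRec h n k) (n ⟨k, hk⟩))
    else solveRec h n k

lemma solveRec_congr [Zero S] (h : Fin d → (Fin d → S) → N → S) {n n' : Fin d → N} (k : ℕ)
    (hn : ∀ j : Fin d, j.1 < k → n j = n' j) : solveRec h n k = solveRec h n' k := by
  induction k with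
  | zero => rfl
  | succ k ih =>
    simp only [solveRec, ih fun j hj => hn j (by omega)]
    split_ifs with hk
    · rw [hn ⟨k, hk⟩ (by simp)]
    · rfl

/-- The placeholder `0` beyond index `k` is the same in `trunc` and `solveRec`, so a solution is
forced one coordinate at a time; this gives uniqueness. -/
lemma trunc_eq_solveRec [Zero S] {h : Fin d → (Fin d → S) → N → S} {n : Fin d → N}
    {z : Fin d → S} (hz : ∀ i, z i = h i (trunc i z) (n i)) (k : ℕ) (hk : k ≤ d) :
    trunc k z = solveRec h n k := by
  induction k with
  | zero => exact trunc_zero z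
  | succ k ih =>
    have hk' : k < d := hk
    rw [trunc_succ hk', hz ⟨k, hk'⟩]
    simp only [solveRec, hk', dite_true, ih hk'.le]

lemma eq_solveRec [Zero S] {h : Fin d → (Fin d → S) → N → S} {n : Fin d → N}
    {z : Fin d → S} (hz : ∀ i, z i = h i (trunc i z) (n i)) : z = solveRec h n d := by
  rw [← trunc_eq_solveRec hz d le_rfl, trunc_of_le le_rfl]

lemma solveRec_apply_of_le [Zero S] (h : Fin d → (Fin d → S) → N → S) (n : Fin d → N) (k : ℕ)
    (j : Fin d) (hj : k ≤ j.1) : solveRec h n k j = 0 := by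
  induction k with
  | zero => rfl
  | succ k ih =>
    simp only [solveRec]
    split_ifs with hk
    · rw [Function.update_of_ne (fun e => by subst e; simp at hj), ih (by omega)]
    · exact ih (by omega)

lemma solveRec_apply_of_lt [Zero S] (h : Fin d → (Fin d → S) → N → S) (n : Fin d → N) (k : ℕ)
    (j : Fin d) (hj : j.1 < k) : solveRec h n k j = h j (solveRec h n j) (n j) := by
  induction k with
  | zero => omega
  | succ k ih =>
    simp only [solveRec]
    split_ifs with hk
    · by_cases e : j = ⟨k, hk⟩
      · subst e; simp
      · rw [Function.update_of_ne e, ih]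
        have : j.1 ≠ k := fun h' => e (Fin.ext h')
        omega
    · exact ih (by omega)

lemma trunc_solveRec [Zero S] (h : Fin d → (Fin d → S) → N → S) (n : Fin d → N) {k l : ℕ}
    (hkl : k ≤ l) : trunc k (solveRec h n l) = solveRec h n k := by
  ext j
  by_cases hj : j.1 < k
  · simp only [trunc, hj, if_true]
    rw [solveRec_apply_of_lt h n k j hj, solveRec_apply_of_lt h n l j (by omega)]
  · simp only [trunc, hj, if_false]
    rw [solveRec_apply_of_le h n k j (by omega)]

/-- `solveRec` solves the recursion. -/
lemma solveRec_spec [Zero S] (h : Fin d → (Fin d → S) → N → S) (n : Fin d → N) (i : Fin d) :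
    solveRec h n d i = h i (trunc i (solveRec h n d)) (n i) := by
  rw [trunc_solveRec h n i.2.le, solveRec_apply_of_lt h n d i i.2]

end Recursions

/-! ### Laws generated sequentially by kernels -/

section SequentialLaws

variable {d : ℕ} {Ω Ω' S S' N : Type*} [MeasurableSpace Ω] [MeasurableSpace Ω']
  [MeasurableSpace S] [MeasurableSpace S'] [MeasurableSpace N]

/-- The process `Z` is generated sequentially by the kernels `κ`: the conditional law of `Z i` given
the coordinates before `i` is `κ i`. -/
def IsSequential [Zero S] (P : Measure Ω) (Z : Ω → Fin d → S)
    (κ : Fin d → Kernel (Fin d → S) S) : Prop :=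
  ∀ i : Fin d, ∀ F : (Fin d → S) × S → ℝ≥0∞, Measurable F →
    ∫⁻ ω, F (trunc i (Z ω), Z ω i) ∂P =
      ∫⁻ ω, ∫⁻ s, F (trunc i (Z ω), s) ∂(κ i (trunc i (Z ω))) ∂P

@[fun_prop]
lemma measurable_trunc [Zero S] (k : ℕ) : Measurable (trunc k : (Fin d → S) → Fin d → S) := by
  refine measurable_pi_lambda _ fun j => ?_
  by_cases h : j.1 < k
  · simpa [trunc, h] using measurable_pi_apply j
  · simp [trunc, h]

/-- Integrating out the last coordinate through its kernel turns a test function of `k + 1`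
coordinates into one of `k` coordinates, and the kernels are the same on both sides. -/
lemma IsSequential.lintegral_trunc_eq [Zero S] {P : Measure Ω} {P' : Measure Ω'}
    [IsProbabilityMeasure P] [IsProbabilityMeasure P'] {Z : Ω → Fin d → S} {Z' : Ω' → Fin d → S}
    {κ : Fin d → Kernel (Fin d → S) S} [∀ i, IsMarkovKernel (κ i)]
    (h : IsSequential P Z κ) (h' : IsSequential P' Z' κ) (k : ℕ) (hk : k ≤ d) :
    ∀ F : (Fin d → S) → ℝ≥0∞, Measurable F →
      ∫⁻ ω, F (trunc k (Z ω)) ∂P = ∫⁻ ω, F (trunc k (Z' ω)) ∂P' := by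
  induction k with
  | zero => intro F _; simp [trunc_zero]
  | succ k ih =>
    intro F hF
    have hF' : Measurable fun p : (Fin d → S) × S =>
        F (Function.update p.1 ⟨k, hk⟩ p.2) := by
      refine hF.comp (measurable_pi_lambda _ fun j => ?_)
      by_cases hj : j = ⟨k, hk⟩
      · subst hj; simpa using measurable_snd
      · simp only [Function.update_of_ne hj]; fun_prop
    simp only [trunc_succ hk]
    have e := h ⟨k, hk⟩ _ hF'
    have e' := h' ⟨k, hk⟩ _ hF'
    dsimp only at e e'
    rw [e, e']
    exact ih (Nat.le_of_succ_le hk) _ (hF'.lintegral_kernel_prod_right' (κ := κ ⟨k, hk⟩))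

/-- The law of a sequentially generated process is determined by its kernels. -/
lemma IsSequential.map_eq [Zero S] {P : Measure Ω} {P' : Measure Ω'}
    [IsProbabilityMeasure P] [IsProbabilityMeasure P'] {Z : Ω → Fin d → S} {Z' : Ω' → Fin d → S}
    {κ : Fin d → Kernel (Fin d → S) S} [∀ i, IsMarkovKernel (κ i)]
    (hZ : Measurable Z) (hZ' : Measurable Z')
    (h : IsSequential P Z κ) (h' : IsSequential P' Z' κ) : P.map Z = P'.map Z' := by
  refine Measure.ext_of_lintegral _ fun F hF => ?_
  rw [lintegral_map hF hZ, lintegral_map hF hZ']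
  simpa [trunc_of_le le_rfl] using h.lintegral_trunc_eq h' d le_rfl F hF

lemma IsSequential.of_map [Zero S] {P : Measure Ω} {T : Ω → Ω'} (hT : Measurable T)
    {Z : Ω' → Fin d → S} (hZ : Measurable Z)
    {κ : Fin d → Kernel (Fin d → S) S} [∀ i, IsMarkovKernel (κ i)]
    (h : IsSequential P (fun ω => Z (T ω)) κ) : IsSequential (P.map T) Z κ := by
  intro i F hF
  rw [lintegral_map (by fun_prop) hT, h i F hF, lintegral_map _ hT]
  exact (hF.lintegral_kernel_prod_right' (κ := κ i)).comp (by fun_prop)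

/-- Serves for projecting a process of pairs to a component and for swapping components. The
condition `φ 0 = 0` preserves the placeholder of truncated histories. -/
lemma IsSequential.comp [Zero S] [Zero S'] {P : Measure Ω} {Z : Ω → Fin d → S}
    {κ : Fin d → Kernel (Fin d → S) S} {κ' : Fin d → Kernel (Fin d → S') S'}
    {φ : S → S'} (hφ : Measurable φ) (h0 : φ 0 = 0)
    (hκ : ∀ i z, κ' i (fun j => φ (z j)) = (κ i z).map φ)
    (h : IsSequential P Z κ) : IsSequential P (fun ω j => φ (Z ω j)) κ' := by
  intro i F hF
  have hF' : Measurable fun p : (Fin d → S) × S => F (fun j => φ (p.1 j), φ p.2) := by fun_prop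
  have := h i _ hF'
  simp only [comp_trunc h0] at this
  rw [this]
  refine lintegral_congr fun ω => ?_
  rw [← comp_trunc h0, hκ, lintegral_map (by fun_prop) hφ]

lemma measurable_solveRec [Zero S] {h : Fin d → (Fin d → S) → N → S}
    (hh : ∀ i, Measurable (Function.uncurry (h i))) (k : ℕ) :
    Measurable fun n => solveRec h n k := by
  induction k with
  | zero => exact measurable_const
  | succ k ih =>
    by_cases hk : k < d
    · simp only [solveRec, hk, dite_true]
      refine measurable_pi_lambda _ fun j => ?_
      by_cases hj : j = ⟨k, hk⟩
      · subst hj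
        simp only [Function.update_self]
        exact (hh ⟨k, hk⟩).comp (ih.prodMk (measurable_pi_apply _))
      · simp only [Function.update_of_ne hj]; fun_prop
    · simpa only [solveRec, hk, dite_false] using ih

/-- The first `i` steps consume only the noises with index below `i`. -/
lemma indepFun_solveRec [Zero S] [Zero N] {P : Measure Ω} {U : Fin d → Ω → N}
    (hU : ∀ i, Measurable (U i)) (hind : iIndepFun U P) {h : Fin d → (Fin d → S) → N → S}
    (hh : ∀ i, Measurable (Function.uncurry (h i))) (i : Fin d) :
    IndepFun (fun ω => solveRec h (fun j => U j ω) i) (U i) P := by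
  classical
  let A : Finset (Fin d) := Finset.univ.filter fun j => j.1 < i.1
  have hA : Disjoint A {i} := by simp [A]
  have key := hind.indepFun_finset A {i} hA hU
  -- Padding the missing noises with `0` is harmless by `solveRec_congr`.
  let ext : ((j : A) → N) → Fin d → N := fun v j => if hj : j ∈ A then v ⟨j, hj⟩ else 0
  have hext : Measurable ext := by
    refine measurable_pi_lambda _ fun j => ?_
    by_cases hj : j ∈ A
    · simp only [ext, hj, dite_true]; fun_prop
    · simp only [ext, hj, dite_false]; fun_prop
  have hψ : Measurable fun v : ((j : ({i} : Finset (Fin d))) → N) =>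
      v ⟨i, Finset.mem_singleton_self i⟩ := measurable_pi_apply _
  have := key.comp ((measurable_solveRec hh i).comp hext) hψ
  have e : (fun ω => solveRec h (fun j => U j ω) i) =
      fun ω => solveRec h (ext fun j => U j ω) i := by
    ext1 ω
    refine solveRec_congr h i fun j hj => ?_
    have hjA : j ∈ A := Finset.mem_filter.2 ⟨Finset.mem_univ _, hj⟩
    simp [ext, hjA]
  rw [e]
  exact this

/-- A process which solves a recursion driven by independent noises is generated sequentially. -/
lemma isSequential_of_recursion [Zero S] [Zero N] {P : Measure Ω} [IsProbabilityMeasure P]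
    {U : Fin d → Ω → N} (hU : ∀ i, Measurable (U i)) (hind : iIndepFun U P)
    {h : Fin d → (Fin d → S) → N → S} (hh : ∀ i, Measurable (Function.uncurry (h i)))
    {Z : Ω → Fin d → S}
    (hZ : ∀ i, ∀ᵐ ω ∂P, Z ω i = h i (trunc i (Z ω)) (U i ω))
    {κ : Fin d → Kernel (Fin d → S) S} (hκ : ∀ i z, κ i z = (P.map (U i)).map (h i z)) :
    IsSequential P Z κ := by
  intro i F hF
  -- `W` is a version of the history that is a function of the earlier noises only, hence
  -- independent of `U i`; Fubini then gives the conditional law.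
  let W : Ω → Fin d → S := fun ω => solveRec h (fun j => U j ω) i
  have hW : Measurable W := (measurable_solveRec hh i).comp (measurable_pi_lambda _ hU)
  have hZ' : ∀ᵐ ω ∂P, ∀ i, Z ω i = h i (trunc i (Z ω)) (U i ω) := ae_all_iff.2 hZ
  have hWZ : ∀ᵐ ω ∂P, trunc i (Z ω) = W ω := by
    filter_upwards [hZ'] with ω hω using trunc_eq_solveRec hω i i.2.le
  have hhi : ∀ z, Measurable (h i z) := fun z => (hh i).comp measurable_prodMk_left
  have hlaw := (indepFun_iff_map_prod_eq_prod_map_map hW.aemeasurable (hU i).aemeasurable).1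
    (indepFun_solveRec hU hind hh i)
  have : IsProbabilityMeasure (P.map (U i)) :=
    Measure.isProbabilityMeasure_map (hU i).aemeasurable
  have : IsProbabilityMeasure (P.map W) := Measure.isProbabilityMeasure_map hW.aemeasurable
  have hFm : Measurable fun p : (Fin d → S) × N => F (p.1, h i p.1 p.2) :=
    hF.comp (measurable_fst.prodMk (hh i))
  calc ∫⁻ ω, F (trunc i (Z ω), Z ω i) ∂P
      = ∫⁻ ω, F (W ω, h i (W ω) (U i ω)) ∂P := by
        refine lintegral_congr_ae ?_
        filter_upwards [hWZ, hZ i] with ω h1 h2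
        rw [h2, h1]
    _ = ∫⁻ p, F (p.1, h i p.1 p.2) ∂(P.map fun ω => (W ω, U i ω)) := by
        rw [lintegral_map hFm (hW.prodMk (hU i))]
    _ = ∫⁻ z, ∫⁻ u, F (z, h i z u) ∂(P.map (U i)) ∂(P.map W) := by
        rw [hlaw, lintegral_prod _ hFm.aemeasurable]
    _ = ∫⁻ ω, ∫⁻ u, F (W ω, h i (W ω) u) ∂(P.map (U i)) ∂P := by
        rw [lintegral_map hFm.lintegral_prod_right' hW]
    _ = _ := by
        refine lintegral_congr_ae ?_
        filter_upwards [hWZ] with ω h1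
        rw [h1, hκ, lintegral_map (by fun_prop) (hhi _)]

end SequentialLaws

/-! ### Measurable maximal couplings -/

/-- Any two Markov kernels have a measurable family of couplings which is optimal for the total
variation distance, the distance being attained on a jointly measurable set. -/
lemma exists_kernel_maximal_coupling {α : Type*} [MeasurableSpace α] (κ η : Kernel α ℝ)
    [IsMarkovKernel κ] [IsMarkovKernel η] :
    ∃ γ : Kernel α (ℝ × ℝ), IsMarkovKernel γ ∧ (∀ a, (γ a).map Prod.fst = κ a) ∧
      (∀ a, (γ a).map Prod.snd = η a) ∧
      ∃ A : Set (α × ℝ), MeasurableSet A ∧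
        ∀ a, γ a {p | p.1 ≠ p.2} + η a (Prod.mk a ⁻¹' A) ≤ κ a (Prod.mk a ⁻¹' A) := by
  let ρ : Kernel α ℝ := κ + η
  let p : α → ℝ → ℝ≥0∞ := Kernel.rnDeriv κ ρ
  let q : α → ℝ → ℝ≥0∞ := Kernel.rnDeriv η ρ
  have hp : Measurable (Function.uncurry p) := Kernel.measurable_rnDeriv κ ρ
  have hq : Measurable (Function.uncurry q) := Kernel.measurable_rnDeriv η ρ
  have hpa : ∀ a, Measurable (p a) := fun a => hp.comp measurable_prodMk_left
  have hqa : ∀ a, Measurable (q a) := fun a => hq.comp measurable_prodMk_left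
  have hκρ : ∀ a, (ρ a).withDensity (p a) = κ a := fun a => by
    have h : κ a ≪ ρ a := Measure.absolutelyContinuous_of_le (Measure.le_add_right le_rfl)
    rw [← Kernel.withDensity_apply _ hp, Kernel.withDensity_rnDeriv_eq h]
  have hηρ : ∀ a, (ρ a).withDensity (q a) = η a := fun a => by
    have h : η a ≪ ρ a := Measure.absolutelyContinuous_of_le (Measure.le_add_left le_rfl)
    rw [← Kernel.withDensity_apply _ hq, Kernel.withDensity_rnDeriv_eq h]
  -- The common part `c` will sit on the diagonal; the excesses `r` and `r'` have equal mass and are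
  -- coupled independently.
  let c : α → Measure ℝ := fun a => (ρ a).withDensity fun x => min (p a x) (q a x)
  let r : α → Measure ℝ := fun a => (ρ a).withDensity fun x => p a x - q a x
  let r' : α → Measure ℝ := fun a => (ρ a).withDensity fun x => q a x - p a x
  have hcr : ∀ a, c a + r a = κ a := fun a => by
    rw [← hκρ a, ← withDensity_add_left (by fun_prop)]
    congr 1; ext x
    rcases le_total (p a x) (q a x) with h | h
    · simp [min_eq_left h, tsub_eq_zero_of_le h]
    · simp [h, add_tsub_cancel_of_le h]
  have hcr' : ∀ a, c a + r' a = η a := fun a => by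
    rw [← hηρ a, ← withDensity_add_left (by fun_prop)]
    congr 1; ext x
    rcases le_total (p a x) (q a x) with h | h
    · simp [h, add_tsub_cancel_of_le h]
    · simp [min_eq_right h, tsub_eq_zero_of_le h]
  have hcm : Measurable c := by
    have : Measurable (Function.uncurry fun a x => min (p a x) (q a x)) := hp.min hq
    have e : c = fun a => ρ.withDensity (fun a x => min (p a x) (q a x)) a := by
      ext1 a; rw [Kernel.withDensity_apply _ this]
    rw [e]; exact Kernel.measurable _
  have hrm : Measurable r := by
    have : Measurable (Function.uncurry fun a x => p a x - q a x) := hp.sub hq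
    have e : r = fun a => ρ.withDensity (fun a x => p a x - q a x) a := by
      ext1 a; rw [Kernel.withDensity_apply _ this]
    rw [e]; exact Kernel.measurable _
  have hrm' : Measurable r' := by
    have : Measurable (Function.uncurry fun a x => q a x - p a x) := hq.sub hp
    have e : r' = fun a => ρ.withDensity (fun a x => q a x - p a x) a := by
      ext1 a; rw [Kernel.withDensity_apply _ this]
    rw [e]; exact Kernel.measurable _
  have hc1 : ∀ a s, c a s ≤ 1 := fun a s =>
    (le_trans (by rw [← hcr a]; exact le_self_add) (prob_le_one (μ := κ a) (s := s)))
  have hr1 : ∀ a s, r a s ≤ 1 := fun a s =>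
    (le_trans (by rw [← hcr a]; exact le_add_self) (prob_le_one (μ := κ a) (s := s)))
  have hr1' : ∀ a s, r' a s ≤ 1 := fun a s =>
    (le_trans (by rw [← hcr' a]; exact le_add_self) (prob_le_one (μ := η a) (s := s)))
  have hrf : ∀ a, IsFiniteMeasure (r a) := fun a => ⟨(hr1 a _).trans_lt ENNReal.one_lt_top⟩
  have hrf' : ∀ a, IsFiniteMeasure (r' a) := fun a => ⟨(hr1' a _).trans_lt ENNReal.one_lt_top⟩
  have hmass : ∀ a, r' a Set.univ = r a Set.univ := fun a => by
    have h1 : c a Set.univ + r a Set.univ = 1 := by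
      rw [← Measure.add_apply, hcr, measure_univ]
    have h2 : c a Set.univ + r' a Set.univ = 1 := by
      rw [← Measure.add_apply, hcr', measure_univ]
    have hfin : c a Set.univ ≠ ∞ := ((hc1 a _).trans_lt ENNReal.one_lt_top).ne
    exact (ENNReal.add_right_inj hfin).1 (h2.trans h1.symm)
  have hdiag : Measurable fun x : ℝ => (x, x) := by fun_prop
  let e : α → ℝ≥0∞ := fun a => r a Set.univ
  -- If `e a = 0`, the factor is `∞` but the product measure vanishes, and `∞ • 0 = 0`.
  let γ₀ : α → Measure (ℝ × ℝ) := fun a =>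
    (c a).map (fun x => (x, x)) + (e a)⁻¹ • (r a).prod (r' a)
  have he : ∀ a, (e a)⁻¹ • (e a • r a) = r a := fun a => by
    by_cases h : e a = 0
    · have : r a = 0 := Measure.measure_univ_eq_zero.1 h
      simp [this]
    · rw [smul_smul, ENNReal.inv_mul_cancel h (measure_ne_top _ _), one_smul]
  have he' : ∀ a, (e a)⁻¹ • (e a • r' a) = r' a := fun a => by
    by_cases h : e a = 0
    · have : r' a = 0 := Measure.measure_univ_eq_zero.1 ((hmass a).trans h)
      simp [this]
    · rw [smul_smul, ENNReal.inv_mul_cancel h (measure_ne_top _ _), one_smul]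
  have hfst : ∀ a, (γ₀ a).map Prod.fst = κ a := fun a => by
    simp only [γ₀]
    rw [Measure.map_add _ _ measurable_fst, Measure.map_smul, Measure.map_map measurable_fst hdiag,
      Measure.map_fst_prod, hmass, he]
    simpa [Function.comp_def] using hcr a
  have hsnd : ∀ a, (γ₀ a).map Prod.snd = η a := fun a => by
    simp only [γ₀]
    rw [Measure.map_add _ _ measurable_snd, Measure.map_smul, Measure.map_map measurable_snd hdiag,
      Measure.map_snd_prod, he']
    simpa [Function.comp_def] using hcr' a
  have hγm : Measurable γ₀ := by
    refine Measure.measurable_of_measurable_coe _ fun s hs => ?_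
    have hprod : Measurable fun a => ((r a).prod (r' a)) s := by
      let R : Kernel α ℝ := ⟨r, hrm⟩
      let R' : Kernel α ℝ := ⟨r', hrm'⟩
      have : IsFiniteKernel R := ⟨1, ENNReal.one_lt_top, fun a => hr1 a _⟩
      have : IsFiniteKernel R' := ⟨1, ENNReal.one_lt_top, fun a => hr1' a _⟩
      have h := Kernel.measurable_coe (R ×ₖ R') hs
      simp only [Kernel.prod_apply] at h
      exact h
    have h1 : Measurable fun a => c a ((fun x : ℝ => (x, x)) ⁻¹' s) :=
      (Measure.measurable_coe (hdiag hs)).comp hcm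
    have h2 : Measurable e := (Measure.measurable_coe MeasurableSet.univ).comp hrm
    simp only [γ₀, Measure.add_apply, Measure.smul_apply, smul_eq_mul, Measure.map_apply hdiag hs]
    exact h1.add (h2.inv.mul hprod)
  have hprob : ∀ a, IsProbabilityMeasure (γ₀ a) := fun a => by
    constructor
    have := congrArg (fun m => m Set.univ) (hfst a)
    simpa [Measure.map_apply measurable_fst MeasurableSet.univ] using this
  -- On the set where `q < p`, the excess `r` has its full mass and `r'` has none, so the difference
  -- of the kernels there is exactly `e a`.
  have hA : MeasurableSet {x : α × ℝ | q x.1 x.2 < p x.1 x.2} := measurableSet_lt hq hp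
  refine ⟨⟨γ₀, hγm⟩, ⟨hprob⟩, hfst, hsnd, _, hA, fun a => ?_⟩
  set B : Set ℝ := Prod.mk a ⁻¹' {x : α × ℝ | q x.1 x.2 < p x.1 x.2} with hB
  have hBm : MeasurableSet B := measurable_prodMk_left hA
  have hrB : r a B = e a := by
    refine measure_congr (Filter.eventuallyEq_set.2 ?_) |>.trans rfl
    have : r a Bᶜ = 0 := by
      rw [withDensity_apply _ hBm.compl, setLIntegral_eq_zero_iff hBm.compl (by fun_prop)]
      refine Filter.Eventually.of_forall fun x hx => tsub_eq_zero_of_le ?_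
      simpa [hB] using hx
    filter_upwards [measure_eq_zero_iff_ae_notMem.1 this] with x hx
    simpa using hx
  have hrB' : r' a B = 0 := by
    rw [withDensity_apply _ hBm, setLIntegral_eq_zero_iff hBm (by fun_prop)]
    refine Filter.Eventually.of_forall fun x hx => tsub_eq_zero_of_le ?_
    have : q a x < p a x := hx
    exact this.le
  have hoff : MeasurableSet {p : ℝ × ℝ | p.1 ≠ p.2} :=
    (measurableSet_eq_fun measurable_fst measurable_snd).compl
  have hγoff : γ₀ a {p | p.1 ≠ p.2} ≤ e a := by
    simp only [γ₀, Measure.add_apply, Measure.smul_apply, smul_eq_mul,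
      Measure.map_apply hdiag hoff]
    have : (fun x : ℝ => (x, x)) ⁻¹' {p : ℝ × ℝ | p.1 ≠ p.2} = ∅ := by ext; simp
    rw [this, measure_empty, zero_add]
    calc (e a)⁻¹ * (r a).prod (r' a) {p | p.1 ≠ p.2}
        ≤ (e a)⁻¹ * (r a).prod (r' a) Set.univ := by gcongr; exact Set.subset_univ _
      _ = (e a)⁻¹ * e a * e a := by
        rw [← Set.univ_prod_univ, Measure.prod_prod, hmass, mul_assoc]
      _ ≤ 1 * e a := by gcongr; exact ENNReal.inv_mul_le_one _
      _ = e a := one_mul _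
  calc γ₀ a {p | p.1 ≠ p.2} + η a B ≤ e a + (c a B + r' a B) := by
        rw [← Measure.add_apply, hcr']; exact add_le_add_left hγoff _
    _ = c a B + r a B := by rw [hrB', hrB, add_zero, add_comm]
    _ = κ a B := by rw [← hcr a, Measure.add_apply]

/-! ### Relative entropy and total variation -/

/-- Pointwise form of the bound of the squared Hellinger distance by relative entropy; it reduces to
`1 - 1/s ≤ log s` at `s = √t`. -/
lemma sq_sqrt_sub_one_le_klFun {t : ℝ} (ht : 0 ≤ t) : (√t - 1) ^ 2 ≤ klFun t := by
  rcases ht.eq_or_lt with rfl | h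
  · simp [klFun]
  have hs : 0 < √t := Real.sqrt_pos.2 h
  have hsq : √t ^ 2 = t := Real.sq_sqrt ht
  have hlog : Real.log t = 2 * Real.log √t := by rw [Real.log_sqrt ht]; ring
  have h1 : 1 - (√t)⁻¹ ≤ Real.log √t := Real.one_sub_inv_le_log_of_pos hs
  have h2 : √t ^ 2 - √t ≤ √t ^ 2 * Real.log √t := by
    have := mul_le_mul_of_nonneg_left h1 (sq_nonneg √t)
    calc √t ^ 2 - √t = √t ^ 2 * (1 - (√t)⁻¹) := by field_simp
      _ ≤ _ := this
  rw [klFun, hlog]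
  nlinarith

/-- A Pinsker type inequality. -/
lemma lintegral_abs_rnDeriv_sub_one_le {α : Type*} [MeasurableSpace α] (μ ν : Measure α)
    [IsProbabilityMeasure μ] [IsProbabilityMeasure ν] (hμν : μ ≪ ν) :
    ∫⁻ x, ENNReal.ofReal |(μ.rnDeriv ν x).toReal - 1| ∂ν ≤ 2 * klDiv μ ν ^ (1 / 2 : ℝ) := by
  let t : α → ℝ := fun x => (μ.rnDeriv ν x).toReal
  have ht : Measurable t := (μ.measurable_rnDeriv ν).ennreal_toReal
  have ht0 : ∀ x, 0 ≤ t x := fun x => ENNReal.toReal_nonneg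
  let f : α → ℝ≥0∞ := fun x => ENNReal.ofReal |√(t x) - 1|
  let g : α → ℝ≥0∞ := fun x => ENNReal.ofReal (√(t x) + 1)
  have hf : Measurable f := by fun_prop
  have hg : Measurable g := by fun_prop
  -- Factor `|t - 1| = |√t - 1| (√t + 1)` for Cauchy–Schwarz: entropy bounds the first factor, and
  -- `(√t + 1)² ≤ 2t + 2` bounds the second.
  have hfac : ∀ x, ENNReal.ofReal |t x - 1| = (f * g) x := fun x => by
    have h0 := Real.sqrt_nonneg (t x)
    simp only [Pi.mul_apply, f, g]
    rw [← ENNReal.ofReal_mul (abs_nonneg _)]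
    congr 1
    rw [← abs_of_nonneg (by positivity : 0 ≤ √(t x) + 1)]
    rw [← abs_mul]
    congr 1
    have := Real.sq_sqrt (ht0 x)
    nlinarith
  have h1 : ∫⁻ x, f x ^ (2 : ℝ) ∂ν ≤ klDiv μ ν := by
    rw [klDiv_eq_lintegral_klFun_of_ac hμν]
    refine lintegral_mono fun x => ?_
    simp only [f]
    rw [ENNReal.ofReal_rpow_of_nonneg (abs_nonneg _) (by norm_num)]
    refine ENNReal.ofReal_le_ofReal ?_
    rw [Real.rpow_two, sq_abs]
    exact sq_sqrt_sub_one_le_klFun (ht0 x)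
  have h2 : ∫⁻ x, g x ^ (2 : ℝ) ∂ν ≤ 4 := by
    calc ∫⁻ x, g x ^ (2 : ℝ) ∂ν ≤ ∫⁻ x, 2 * μ.rnDeriv ν x + 2 ∂ν := by
          refine lintegral_mono_ae ?_
          filter_upwards [μ.rnDeriv_ne_top ν] with x hx
          simp only [g]
          rw [ENNReal.ofReal_rpow_of_nonneg (by positivity) (by norm_num), Real.rpow_two]
          have : 2 * μ.rnDeriv ν x + 2 = ENNReal.ofReal (2 * t x + 2) := by
            rw [ENNReal.ofReal_add (by have := ht0 x; positivity) (by norm_num),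
              ENNReal.ofReal_mul (by norm_num), ENNReal.ofReal_toReal hx]
            simp
          rw [this]
          refine ENNReal.ofReal_le_ofReal ?_
          nlinarith [Real.sq_sqrt (ht0 x), sq_nonneg (√(t x) - 1)]
      _ ≤ 4 := by
          rw [lintegral_add_right _ measurable_const, lintegral_const_mul _ (μ.measurable_rnDeriv ν),
            Measure.lintegral_rnDeriv hμν]
          simp; norm_num
  have h4 : (4 : ℝ≥0∞) ^ (1 / 2 : ℝ) = 2 := by
    rw [show (4 : ℝ≥0∞) = 2 ^ (2 : ℝ) by norm_num, ← ENNReal.rpow_mul]; norm_num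
  calc ∫⁻ x, ENNReal.ofReal |t x - 1| ∂ν = ∫⁻ x, (f * g) x ∂ν := lintegral_congr hfac
    _ ≤ (∫⁻ x, f x ^ (2 : ℝ) ∂ν) ^ (1 / 2 : ℝ) * (∫⁻ x, g x ^ (2 : ℝ) ∂ν) ^ (1 / 2 : ℝ) :=
        ENNReal.lintegral_mul_le_Lp_mul_Lq ν Real.HolderConjugate.two_two hf.aemeasurable
          hg.aemeasurable
    _ ≤ klDiv μ ν ^ (1 / 2 : ℝ) * 4 ^ (1 / 2 : ℝ) := by gcongr
    _ = 2 * klDiv μ ν ^ (1 / 2 : ℝ) := by rw [h4, mul_comm]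

/-- For `0 ≤ f ≤ 1`, changing measure costs at most `∫ |dμ/dν - 1| dν`. Without absolute continuity
the divergence is infinite and there is nothing to prove. -/
lemma lintegral_le_lintegral_add_klDiv {α : Type*} [MeasurableSpace α] (μ ν : Measure α)
    [IsProbabilityMeasure μ] [IsProbabilityMeasure ν] {f : α → ℝ≥0∞} (hf : Measurable f)
    (hf1 : ∀ x, f x ≤ 1) :
    ∫⁻ x, f x ∂μ ≤ ∫⁻ x, f x ∂ν + 2 * klDiv μ ν ^ (1 / 2 : ℝ) ∧
      ∫⁻ x, f x ∂ν ≤ ∫⁻ x, f x ∂μ + 2 * klDiv μ ν ^ (1 / 2 : ℝ) := by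
  by_cases hμν : μ ≪ ν
  swap
  · have : klDiv μ ν = ∞ := klDiv_of_not_ac hμν
    simp [this]
  have hle := lintegral_abs_rnDeriv_sub_one_le μ ν hμν
  let w : α → ℝ≥0∞ := fun x => ENNReal.ofReal |(μ.rnDeriv ν x).toReal - 1|
  have ht : Measurable (μ.rnDeriv ν) := μ.measurable_rnDeriv ν
  have hw : Measurable w := by fun_prop
  have hμ : ∫⁻ x, f x ∂μ = ∫⁻ x, μ.rnDeriv ν x * f x ∂ν :=
    (lintegral_rnDeriv_mul hμν hf.aemeasurable).symm
  have hb : ∀ᵐ x ∂ν, μ.rnDeriv ν x ≤ 1 + w x ∧ 1 ≤ μ.rnDeriv ν x + w x := by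
    filter_upwards [μ.rnDeriv_ne_top ν] with x hx
    have h0 : 0 ≤ (μ.rnDeriv ν x).toReal := ENNReal.toReal_nonneg
    have h1 : μ.rnDeriv ν x = ENNReal.ofReal (μ.rnDeriv ν x).toReal :=
      (ENNReal.ofReal_toReal hx).symm
    have ha := le_abs_self ((μ.rnDeriv ν x).toReal - 1)
    have hb := neg_abs_le ((μ.rnDeriv ν x).toReal - 1)
    constructor
    · rw [h1, ← ENNReal.ofReal_one, ← ENNReal.ofReal_add zero_le_one (abs_nonneg _)]
      exact ENNReal.ofReal_le_ofReal (by linarith)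
    · nth_rw 1 [h1]
      rw [← ENNReal.ofReal_one, ← ENNReal.ofReal_add h0 (abs_nonneg _)]
      exact ENNReal.ofReal_le_ofReal (by linarith)
  constructor
  · calc ∫⁻ x, f x ∂μ = ∫⁻ x, μ.rnDeriv ν x * f x ∂ν := hμ
      _ ≤ ∫⁻ x, f x + w x ∂ν := by
        refine lintegral_mono_ae ?_
        filter_upwards [hb] with x hx
        calc μ.rnDeriv ν x * f x ≤ (1 + w x) * f x := by gcongr; exact hx.1
          _ = f x + w x * f x := by ring
          _ ≤ f x + w x * 1 := by gcongr; exact hf1 x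
          _ = f x + w x := by rw [mul_one]
      _ = ∫⁻ x, f x ∂ν + ∫⁻ x, w x ∂ν := lintegral_add_left hf _
      _ ≤ _ := by gcongr
  · calc ∫⁻ x, f x ∂ν
      _ ≤ ∫⁻ x, μ.rnDeriv ν x * f x + w x ∂ν := by
        refine lintegral_mono_ae ?_
        filter_upwards [hb] with x hx
        calc f x = 1 * f x := (one_mul _).symm
          _ ≤ (μ.rnDeriv ν x + w x) * f x := by gcongr; exact hx.2
          _ = μ.rnDeriv ν x * f x + w x * f x := by ring
          _ ≤ μ.rnDeriv ν x * f x + w x * 1 := by gcongr; exact hf1 x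
          _ = _ := by rw [mul_one]
      _ = ∫⁻ x, f x ∂μ + ∫⁻ x, w x ∂ν := by rw [lintegral_add_right _ hw, hμ]
      _ ≤ _ := by gcongr

/-! ### Compatible measures and construction of causal laws -/

section Graphs

variable {d : ℕ} {G : Digraph (Fin d)}

/-- The restriction of a vector to the parents of `i`. -/
def parentSlice (G : Digraph (Fin d)) (i : Fin d) (z : Fin d → ℝ) : Parents G i → ℝ :=
  fun j => z j.1

/-- The restrictions to the parents of `i` of the two components of a vector of pairs. -/
def pairSlice (G : Digraph (Fin d)) (i : Fin d) (z : Fin d → ℝ × ℝ) :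
    (Parents G i → ℝ) × (Parents G i → ℝ) :=
  (fun j => (z j.1).1, fun j => (z j.1).2)

/-- A pair of vectors, viewed as a vector of pairs. -/
def pairProcess (p : EuclideanSpace ℝ (Fin d) × EuclideanSpace ℝ (Fin d)) : Fin d → ℝ × ℝ :=
  fun j => (p.1 j, p.2 j)

@[fun_prop]
lemma measurable_parentSlice (i : Fin d) : Measurable (parentSlice G i) := by
  unfold parentSlice; fun_prop

@[fun_prop]
lemma measurable_pairSlice (i : Fin d) : Measurable (pairSlice G i) := by
  unfold pairSlice; fun_prop

@[fun_prop]
lemma measurable_pairProcess : Measurable (pairProcess (d := d)) := by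
  unfold pairProcess; fun_prop

lemma parentSlice_trunc (hG : IsSortedDAG G) (i : Fin d) (z : Fin d → ℝ) :
    parentSlice G i (trunc i z) = parentSlice G i z := by
  ext j
  have : j.1.1 < i.1 := hG _ _ j.2
  simp [parentSlice, trunc, this]

lemma pairSlice_trunc (hG : IsSortedDAG G) (i : Fin d) (z : Fin d → ℝ × ℝ) :
    pairSlice G i (trunc i z) = pairSlice G i z := by
  have h : ∀ j : Parents G i, trunc i z j.1 = z j.1 := fun j => by
    have : j.1.1 < i.1 := hG _ _ j.2
    simp [trunc, this]
  simp [pairSlice, h]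

/-- A `G`-compatible measure is generated by kernels which depend on the parents only. -/
lemma IsGCompatible.exists_isSequential (hG : IsSortedDAG G)
    {μ : Measure (EuclideanSpace ℝ (Fin d))} (h : IsGCompatible G μ) :
    ∃ M : (i : Fin d) → Kernel (Parents G i → ℝ) ℝ, (∀ i, IsMarkovKernel (M i)) ∧
      IsSequential μ (fun x => (x : Fin d → ℝ))
        (fun i => (M i).comap (parentSlice G i) (measurable_parentSlice i)) := by
  obtain ⟨Ω, _, P, _, X, U, f, hX, hU, hf, rfl, hind, hrec⟩ := h
  have hprob : ∀ i, IsProbabilityMeasure (P.map (U i)) := fun i =>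
    Measure.isProbabilityMeasure_map (hU i).aemeasurable
  let M : (i : Fin d) → Kernel (Parents G i → ℝ) ℝ := fun i =>
    (Kernel.id ×ₖ Kernel.const _ (P.map (U i))).map (f i)
  have hM : ∀ i, IsMarkovKernel (M i) := fun i => Kernel.IsMarkovKernel.map _ (hf i)
  refine ⟨M, hM, IsSequential.of_map hX (by fun_prop) ?_⟩
  refine isSequential_of_recursion hU hind (h := fun i z u => f i (parentSlice G i z, u))
    (fun i => (hf i).comp (by fun_prop)) (fun i => ?_) (fun i z => ?_)
  · filter_upwards [hrec i] with ω hω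
    rw [hω, parentSlice_trunc hG]
    rfl
  · simp only [Kernel.comap_apply, M]
    rw [Kernel.map_apply _ (hf i), Kernel.prod_apply, Kernel.id_apply, Kernel.const_apply,
      Measure.dirac_prod, Measure.map_map (hf i) measurable_prodMk_left]
    rfl

open unitInterval in
/-- Kernels on pairs whose first marginal depends only on the first argument generate a causal
law. -/
lemma exists_isGCausal_isSequential (hG : IsSortedDAG G)
    (M : (i : Fin d) → Kernel (Parents G i → ℝ) ℝ) [∀ i, IsMarkovKernel (M i)]
    (γ : (i : Fin d) → Kernel ((Parents G i → ℝ) × (Parents G i → ℝ)) (ℝ × ℝ))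
    [∀ i, IsMarkovKernel (γ i)] (hγ : ∀ i a, (γ i a).map Prod.fst = M i a.1) :
    ∃ π : Measure (EuclideanSpace ℝ (Fin d) × EuclideanSpace ℝ (Fin d)),
      IsProbabilityMeasure π ∧ IsGCausal G π ∧
      IsSequential π pairProcess
        (fun i => (γ i).comap (pairSlice G i) (measurable_pairSlice i)) := by
  choose f hf hfM using fun i => (M i).exists_measurable_map_eq_unitInterval
  choose g hg hgγ using fun i => (γ i).condKernel.exists_measurable_map_eq_unitInterval
  let P : Measure (Fin d → I × I) := volume
  -- Each vertex has two uniform noises: the first draws `X i` from `M i`, the second draws `X' i`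
  -- from its conditional law given `X i` and both parent slices.
  let h : (i : Fin d) → (Fin d → ℝ × ℝ) → I × I → ℝ × ℝ := fun i z n =>
    (f i (pairSlice G i z).1 n.1, g i (pairSlice G i z, f i (pairSlice G i z).1 n.1) n.2)
  let Z : (Fin d → I × I) → Fin d → ℝ × ℝ := fun ω => solveRec h ω d
  have hhx : ∀ i, Measurable fun p : (Fin d → ℝ × ℝ) × (I × I) =>
      f i (pairSlice G i p.1).1 p.2.1 := fun i =>
    (hf i).comp (f := fun p : (Fin d → ℝ × ℝ) × (I × I) => ((pairSlice G i p.1).1, p.2.1))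
      (by fun_prop)
  have hh : ∀ i, Measurable (Function.uncurry (h i)) := fun i =>
    (hhx i).prodMk ((hg i).comp
      (((by fun_prop : Measurable fun p : (Fin d → ℝ × ℝ) × (I × I) =>
        pairSlice G i p.1).prodMk (hhx i)).prodMk (by fun_prop)))
  have hZ : Measurable Z := measurable_solveRec hh d
  have hZrec : ∀ ω i, Z ω i = h i (trunc i (Z ω)) (ω i) := fun ω i => solveRec_spec h ω i
  have hind : iIndepFun (fun (i : Fin d) (ω : Fin d → I × I) => ω i) P :=
    iIndepFun_pi (X := fun _ => id) (fun _ => aemeasurable_id)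
  have hlaw : ∀ i, P.map (fun ω : Fin d → I × I => ω i) = volume := fun i =>
    (measurePreserving_eval (fun _ : Fin d => (volume : Measure (I × I))) i).map_eq
  have hκ : ∀ i z, (γ i).comap (pairSlice G i) (measurable_pairSlice i) z =
      (P.map (fun ω : Fin d → I × I => ω i)).map (h i z) := fun i z => by
    have hm : Measurable (h i z) := (hh i).comp measurable_prodMk_left
    have hfz : Measurable (f i (pairSlice G i z).1) := (hf i).comp measurable_prodMk_left
    have hfst : (γ i).fst (pairSlice G i z) = volume.map (f i (pairSlice G i z).1) := by
      rw [hfM, Kernel.fst_apply, hγ]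
    rw [hlaw, Kernel.comap_apply]
    refine Measure.ext_of_lintegral _ fun F hF => ?_
    rw [lintegral_map hF hm]
    conv_lhs => rw [← (γ i).disintegrate (γ i).condKernel]
    rw [Kernel.lintegral_compProd _ _ _ hF, hfst, lintegral_map _ hfz]
    · rw [Measure.volume_eq_prod, lintegral_prod (fun n => F (h i z n)) (hF.comp hm).aemeasurable]
      refine lintegral_congr fun v => ?_
      have hgv : ∀ a, Measurable (g i a) := fun a => (hg i).comp measurable_prodMk_left
      rw [← hgγ, lintegral_map (by fun_prop) (hgv _)]
    · exact (hF.comp (by fun_prop : Measurable fun p : (((Parents G i → ℝ) ×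
        (Parents G i → ℝ)) × ℝ) × ℝ => (p.1.2, p.2))).lintegral_kernel_prod_right'
        (κ := (γ i).condKernel) |>.comp measurable_prodMk_left
  let X : (Fin d → I × I) → EuclideanSpace ℝ (Fin d) := fun ω => WithLp.toLp 2 fun j => (Z ω j).1
  let X' : (Fin d → I × I) → EuclideanSpace ℝ (Fin d) := fun ω => WithLp.toLp 2 fun j => (Z ω j).2
  have hX : Measurable X := by fun_prop
  have hX' : Measurable X' := by fun_prop
  have hsl : ∀ i ω, pairSlice G i (trunc i (Z ω)) = (paSlice G i (X ω), paSlice G i (X' ω)) :=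
    fun i ω => pairSlice_trunc hG i (Z ω)
  refine ⟨P.map fun ω => (X ω, X' ω), Measure.isProbabilityMeasure_map (by fun_prop), ?_, ?_⟩
  · refine ⟨_, _, P, inferInstance, X, X', fun i ω => ((ω i).2 : ℝ),
      -- The noises in `IsGCausal` are real, so the uniform variable is embedded in `ℝ` and
      -- projected back to the unit interval.
      fun i p => g i ((p.2.1, p.2.2.1), p.1) (Set.projIcc 0 1 zero_le_one p.2.2.2),
      hX, hX', by fun_prop, fun i => ?_, rfl, ?_, ?_, fun i => Filter.Eventually.of_forall ?_⟩
    · have hproj : Measurable (Set.projIcc (0 : ℝ) 1 zero_le_one) := continuous_projIcc.measurable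
      exact (hg i).comp (f := fun p : ℝ × (Parents G i → ℝ) × (Parents G i → ℝ) × ℝ =>
        (((p.2.1, p.2.2.1), p.1), Set.projIcc (0 : ℝ) 1 zero_le_one p.2.2.2)) (by fun_prop)
    · exact hind.comp (fun _ p => ((p.2 : I) : ℝ)) (fun _ => by fun_prop)
    · let V : (Fin d → I × I) → Fin d → I := fun ω j => (ω j).1
      let U : (Fin d → I × I) → Fin d → I := fun ω j => (ω j).2
      have hVU : IndepFun V U P := by
        have hpres := volume_measurePreserving_arrowProdEquivProdArrow I I (Fin d)
        have hmap : P.map (fun ω => (V ω, U ω)) = (volume : Measure (Fin d → I)).prod volume :=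
          hpres.map_eq
        have hVm : Measurable V := by fun_prop
        have hUm : Measurable U := by fun_prop
        have e1 : P.map V = volume := by
          have := congrArg (Measure.map Prod.fst) hmap
          rw [Measure.map_map measurable_fst (by fun_prop), Measure.map_fst_prod] at this
          simpa [Function.comp_def] using this
        have e2 : P.map U = volume := by
          have := congrArg (Measure.map Prod.snd) hmap
          rw [Measure.map_map measurable_snd (by fun_prop), Measure.map_snd_prod] at this
          simpa [Function.comp_def] using this
        rw [indepFun_iff_map_prod_eq_prod_map_map hVm.aemeasurable hUm.aemeasurable, e1, e2, hmap]
      let hx : (i : Fin d) → (Fin d → ℝ) → I → ℝ := fun i z v => f i (parentSlice G i z) v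
      have hhx : ∀ i, Measurable (Function.uncurry (hx i)) := fun i => (hf i).comp
        (f := fun p : (Fin d → ℝ) × I => (parentSlice G i p.1, p.2)) (by fun_prop)
      -- By the marginal condition `X` solves its own recursion driven by `V` alone, so it is
      -- independent of the noises `U`.
      have hXV : X = fun ω => WithLp.toLp 2 (solveRec hx (V ω) d) := by
        ext1 ω
        refine congrArg (WithLp.toLp 2) (eq_solveRec fun i => ?_)
        rw [hZrec]
        simp only [h, hx, V, hsl, parentSlice_trunc hG]
        rfl
      rw [hXV]
      exact hVU.comp (φ := fun v => WithLp.toLp 2 (solveRec hx v d))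
        (ψ := fun u i => ((u i : I) : ℝ)) ((WithLp.measurable_toLp 2 _).comp
          (measurable_solveRec hhx d)) (by fun_prop)
    · intro ω
      have e := hZrec ω i
      have e1 : X ω i = (h i (trunc i (Z ω)) (ω i)).1 := congrArg Prod.fst e
      have e2 : X' ω i = (h i (trunc i (Z ω)) (ω i)).2 := congrArg Prod.snd e
      rw [e2, e1]
      simp only [h, hsl, Set.projIcc_val]
  · refine IsSequential.of_map (by fun_prop) measurable_pairProcess ?_
    exact isSequential_of_recursion (fun i => measurable_pi_apply i) hind hh
      (fun i => Filter.Eventually.of_forall fun ω => hZrec ω i) hκ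

end Graphs

/-! ### Bicausal couplings and the probability of separation -/

section Estimates

variable {d : ℕ} {G : Digraph (Fin d)}

lemma eq_of_map_pairProcess_eq
    {π π' : Measure (EuclideanSpace ℝ (Fin d) × EuclideanSpace ℝ (Fin d))}
    (h : π.map pairProcess = π'.map pairProcess) : π = π' := by
  let u : (Fin d → ℝ × ℝ) → EuclideanSpace ℝ (Fin d) × EuclideanSpace ℝ (Fin d) :=
    fun q => (WithLp.toLp 2 fun j => (q j).1, WithLp.toLp 2 fun j => (q j).2)
  have hu : Measurable u := by fun_prop
  have := congrArg (Measure.map u) h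
  rw [Measure.map_map hu measurable_pairProcess, Measure.map_map hu measurable_pairProcess] at this
  have e : u ∘ pairProcess = id := rfl
  simpa [e] using this

lemma eq_of_isSequential {μ ν : Measure (EuclideanSpace ℝ (Fin d))} [IsProbabilityMeasure μ]
    [IsProbabilityMeasure ν] {κ : Fin d → Kernel (Fin d → ℝ) ℝ} [∀ i, IsMarkovKernel (κ i)]
    (hμ : IsSequential μ (fun x => (x : Fin d → ℝ)) κ)
    (hν : IsSequential ν (fun x => (x : Fin d → ℝ)) κ) : μ = ν := by
  have h := congrArg (Measure.map (WithLp.toLp 2 : (Fin d → ℝ) → EuclideanSpace ℝ (Fin d)))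
    (hμ.map_eq (by fun_prop) (by fun_prop) hν)
  rw [Measure.map_map (by fun_prop) (by fun_prop), Measure.map_map (by fun_prop) (by fun_prop)] at h
  have e : (WithLp.toLp 2 : (Fin d → ℝ) → EuclideanSpace ℝ (Fin d)) ∘
    (fun x : EuclideanSpace ℝ (Fin d) => (x : Fin d → ℝ)) = id := rfl
  simpa [e] using h

/-- Couplings of the kernels of two `G`-compatible measures generate a bicausal coupling. -/
lemma exists_bicausal_isSequential (hG : IsSortedDAG G)
    {μ ν : Measure (EuclideanSpace ℝ (Fin d))} [IsProbabilityMeasure μ] [IsProbabilityMeasure ν]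
    {M M' : (i : Fin d) → Kernel (Parents G i → ℝ) ℝ} [∀ i, IsMarkovKernel (M i)]
    [∀ i, IsMarkovKernel (M' i)]
    (hμ : IsSequential μ (fun x => (x : Fin d → ℝ))
      (fun i => (M i).comap (parentSlice G i) (measurable_parentSlice i)))
    (hν : IsSequential ν (fun x => (x : Fin d → ℝ))
      (fun i => (M' i).comap (parentSlice G i) (measurable_parentSlice i)))
    (γ : (i : Fin d) → Kernel ((Parents G i → ℝ) × (Parents G i → ℝ)) (ℝ × ℝ))
    [∀ i, IsMarkovKernel (γ i)] (hγ : ∀ i a, (γ i a).map Prod.fst = M i a.1)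
    (hγ' : ∀ i a, (γ i a).map Prod.snd = M' i a.2) :
    ∃ π ∈ bicausalCouplings G μ ν, IsSequential π pairProcess
        (fun i => (γ i).comap (pairSlice G i) (measurable_pairSlice i)) := by
  obtain ⟨π, hπ, hπc, hπs⟩ := exists_isGCausal_isSequential hG M γ hγ
  let σ : (i : Fin d) → Kernel ((Parents G i → ℝ) × (Parents G i → ℝ)) (ℝ × ℝ) :=
    fun i => ((γ i).comap Prod.swap measurable_swap).map Prod.swap
  have hσ : ∀ i a, σ i a = (γ i a.swap).map Prod.swap := fun i a => by
    simp only [σ]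
    rw [Kernel.map_apply _ measurable_swap, Kernel.comap_apply]
  have : ∀ i, IsMarkovKernel (σ i) := fun i => Kernel.IsMarkovKernel.map _ measurable_swap
  obtain ⟨π', hπ', hπc', hπs'⟩ := exists_isGCausal_isSequential hG M' σ fun i a => by
    rw [hσ, Measure.map_map measurable_fst measurable_swap]
    exact hγ' i a.swap
  -- Both laws are generated by the swapped kernels `σ`, so the causality of `π'` passes to the swap
  -- of `π`.
  have hswap : π.map Prod.swap = π' := by
    have : IsProbabilityMeasure (π.map Prod.swap) :=
      Measure.isProbabilityMeasure_map measurable_swap.aemeasurable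
    refine eq_of_map_pairProcess_eq (IsSequential.map_eq measurable_pairProcess
      measurable_pairProcess (IsSequential.of_map measurable_swap measurable_pairProcess ?_) hπs')
    refine IsSequential.comp (φ := Prod.swap) measurable_swap rfl (fun i z => ?_) hπs
    rw [Kernel.comap_apply, Kernel.comap_apply, hσ]
    rfl
  refine ⟨π, ⟨?_, ?_, hπc, hswap ▸ hπc'⟩, hπs⟩
  · have : IsProbabilityMeasure (π.map Prod.fst) :=
      Measure.isProbabilityMeasure_map measurable_fst.aemeasurable
    refine eq_of_isSequential (IsSequential.of_map measurable_fst (by fun_prop) ?_) hμ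
    refine IsSequential.comp (φ := Prod.fst) measurable_fst rfl (fun i z => ?_) hπs
    rw [Kernel.comap_apply, Kernel.comap_apply, hγ]
    rfl
  · have : IsProbabilityMeasure (π.map Prod.snd) :=
      Measure.isProbabilityMeasure_map measurable_snd.aemeasurable
    refine eq_of_isSequential (IsSequential.of_map measurable_snd (by fun_prop) ?_) hν
    refine IsSequential.comp (φ := Prod.snd) measurable_snd rfl (fun i z => ?_) hπs
    rw [Kernel.comap_apply, Kernel.comap_apply, hγ']
    rfl

/-- Turns an average of transition probabilities into the probability of an event, whose change
under `μ` versus `ν` is controlled by the entropy. -/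
lemma IsSequential.lintegral_indicator_parentSlice (hG : IsSortedDAG G)
    {μ : Measure (EuclideanSpace ℝ (Fin d))} {M : (i : Fin d) → Kernel (Parents G i → ℝ) ℝ}
    (hμ : IsSequential μ (fun x => (x : Fin d → ℝ))
      (fun i => (M i).comap (parentSlice G i) (measurable_parentSlice i)))
    (i : Fin d) {B : Set ((Parents G i → ℝ) × ℝ)} (hB : MeasurableSet B) :
    ∫⁻ x, B.indicator 1 (parentSlice G i x, x i) ∂μ =
      ∫⁻ x, M i (parentSlice G i x) (Prod.mk (parentSlice G i x) ⁻¹' B) ∂μ := by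
  have h := hμ i (fun q => B.indicator 1 (parentSlice G i q.1, q.2))
    ((measurable_one.indicator hB).comp (by fun_prop))
  simp only [parentSlice_trunc hG, Kernel.comap_apply] at h
  rw [h]
  refine lintegral_congr fun x => ?_
  rw [← lintegral_indicator_one (measurable_prodMk_left hB)]
  rfl

/-- The transition kernels of two `G`-compatible measures are close on average. -/
lemma lintegral_le_klDiv_of_isSequential (hG : IsSortedDAG G)
    {μ ν : Measure (EuclideanSpace ℝ (Fin d))} [IsProbabilityMeasure μ] [IsProbabilityMeasure ν]
    {M M' : (i : Fin d) → Kernel (Parents G i → ℝ) ℝ} [∀ i, IsMarkovKernel (M' i)]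
    (hμ : IsSequential μ (fun x => (x : Fin d → ℝ))
      (fun i => (M i).comap (parentSlice G i) (measurable_parentSlice i)))
    (hν : IsSequential ν (fun x => (x : Fin d → ℝ))
      (fun i => (M' i).comap (parentSlice G i) (measurable_parentSlice i)))
    (i : Fin d) {B : Set ((Parents G i → ℝ) × ℝ)} (hB : MeasurableSet B)
    {e : (Parents G i → ℝ) → ℝ≥0∞}
    (hle : ∀ y, e y + M' i y (Prod.mk y ⁻¹' B) ≤ M i y (Prod.mk y ⁻¹' B)) :
    ∫⁻ x, e (parentSlice G i x) ∂μ ≤ 4 * klDiv μ ν ^ (1 / 2 : ℝ) := by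
  set δ := 2 * klDiv μ ν ^ (1 / 2 : ℝ)
  let m' : EuclideanSpace ℝ (Fin d) → ℝ≥0∞ := fun x =>
    M' i (parentSlice G i x) (Prod.mk (parentSlice G i x) ⁻¹' B)
  have hm' : Measurable m' :=
    (Kernel.measurable_kernel_prodMk_left (κ := M' i) hB).comp (by fun_prop)
  have hm'1 : ∀ x, m' x ≤ 1 := fun x => prob_le_one
  have hφ : Measurable fun x : EuclideanSpace ℝ (Fin d) =>
      B.indicator (1 : (Parents G i → ℝ) × ℝ → ℝ≥0∞) (parentSlice G i x, x i) :=
    (measurable_one.indicator hB).comp (by fun_prop)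
  have hfin : ∫⁻ x, m' x ∂μ ≠ ∞ :=
    ((lintegral_mono hm'1).trans_lt (by simp)).ne
  -- Adding the finite `∫ m' ∂μ` to both sides avoids truncated subtraction. Below, `μ` is replaced
  -- by `ν` for the event and then `ν` by `μ` for `m'`: two errors `δ`, hence the `4`.
  refine ENNReal.le_of_add_le_add_right hfin ?_
  calc ∫⁻ x, e (parentSlice G i x) ∂μ + ∫⁻ x, m' x ∂μ
      = ∫⁻ x, e (parentSlice G i x) + m' x ∂μ := (lintegral_add_right _ hm').symm
    _ ≤ ∫⁻ x, M i (parentSlice G i x) (Prod.mk (parentSlice G i x) ⁻¹' B) ∂μ :=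
        lintegral_mono fun x => hle _
    _ = ∫⁻ x, B.indicator 1 (parentSlice G i x, x i) ∂μ :=
        (hμ.lintegral_indicator_parentSlice hG i hB).symm
    _ ≤ ∫⁻ x, B.indicator 1 (parentSlice G i x, x i) ∂ν + δ :=
        (lintegral_le_lintegral_add_klDiv μ ν hφ
          fun x => Set.indicator_le_self' (by simp) _).1
    _ = ∫⁻ x, m' x ∂ν + δ := by rw [hν.lintegral_indicator_parentSlice hG i hB]
    _ ≤ ∫⁻ x, m' x ∂μ + δ + δ := by
        gcongr; exact (lintegral_le_lintegral_add_klDiv μ ν hm' hm'1).2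
    _ = 4 * klDiv μ ν ^ (1 / 2 : ℝ) + ∫⁻ x, m' x ∂μ := by simp only [δ]; ring

/-- There is a bicausal coupling which charges the complement of the diagonal by at most a multiple
of the square root of the relative entropy. -/
lemma exists_bicausal_measure_ne_le (hG : IsSortedDAG G)
    {μ ν : Measure (EuclideanSpace ℝ (Fin d))} [IsProbabilityMeasure μ] [IsProbabilityMeasure ν]
    (hμ : IsGCompatible G μ) (hν : IsGCompatible G ν) :
    ∃ π ∈ bicausalCouplings G μ ν,
      π {p | p.1 ≠ p.2} ≤ d * (4 * klDiv μ ν ^ (1 / 2 : ℝ)) := by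
  obtain ⟨M, hM, hμs⟩ := hμ.exists_isSequential hG
  obtain ⟨M', hM', hνs⟩ := hν.exists_isSequential hG
  choose γ hγm hγ hγ' A hA hle using fun i => exists_kernel_maximal_coupling
    ((M i).comap (Prod.fst : (Parents G i → ℝ) × (Parents G i → ℝ) → _) measurable_fst)
    ((M' i).comap (Prod.snd : (Parents G i → ℝ) × (Parents G i → ℝ) → _) measurable_snd)
  obtain ⟨π, hπ, hπs⟩ := exists_bicausal_isSequential hG hμs hνs γ hγ hγ'
  refine ⟨π, hπ, ?_⟩
  let off : Set (ℝ × ℝ) := {p | p.1 ≠ p.2}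
  have hoff : MeasurableSet off := (measurableSet_eq_fun measurable_fst measurable_snd).compl
  -- Conditional probability of splitting at `i` when both parent slices equal `y`.
  let e : (i : Fin d) → (Parents G i → ℝ) → ℝ≥0∞ := fun i y => γ i (y, y) off
  have he : ∀ i, Measurable (e i) := fun i =>
    ((γ i).measurable_coe hoff).comp (by fun_prop : Measurable fun y : Parents G i → ℝ => (y, y))
  have hbound : ∀ i, ∫⁻ x, e i (parentSlice G i x) ∂μ ≤ 4 * klDiv μ ν ^ (1 / 2 : ℝ) := fun i =>
    lintegral_le_klDiv_of_isSequential hG hμs hνs i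
      (B := (fun q : (Parents G i → ℝ) × ℝ => ((q.1, q.1), q.2)) ⁻¹' A i)
      ((by fun_prop : Measurable fun q : (Parents G i → ℝ) × ℝ => ((q.1, q.1), q.2)) (hA i))
      fun y => hle i (y, y)
  -- The event that the paths split at `i` although their parents agree. It involves only the
  -- history and the current pair, so `hπs` applies.
  let D : (i : Fin d) → Set ((Fin d → ℝ × ℝ) × (ℝ × ℝ)) := fun i =>
    {q | (pairSlice G i q.1).1 = (pairSlice G i q.1).2 ∧ q.2 ∈ off}
  have hD : ∀ i, MeasurableSet (D i) := fun i =>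
    (measurableSet_eq_fun (by fun_prop) (by fun_prop)).inter (measurable_snd hoff)
  have hstep : ∀ i : Fin d, π {p | (trunc i (pairProcess p), pairProcess p i) ∈ D i} ≤
      4 * klDiv μ ν ^ (1 / 2 : ℝ) := fun i => by
    have hm : Measurable fun p : EuclideanSpace ℝ (Fin d) × EuclideanSpace ℝ (Fin d) =>
      (trunc i (pairProcess p), pairProcess p i) := by fun_prop
    have h := hπs i _ (measurable_one.indicator (hD i))
    calc π {p | (trunc i (pairProcess p), pairProcess p i) ∈ D i}
        = ∫⁻ p, (D i).indicator 1 (trunc i (pairProcess p), pairProcess p i) ∂π :=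
          (lintegral_indicator_one (hm (hD i))).symm
      _ = _ := h
      _ ≤ ∫⁻ p, e i (parentSlice G i p.1) ∂π := by
          refine lintegral_mono fun p => ?_
          have hD' : (fun s => (D i).indicator (1 : (Fin d → ℝ × ℝ) × (ℝ × ℝ) → ℝ≥0∞)
              (trunc i (pairProcess p), s)) =
            (Prod.mk (trunc i (pairProcess p)) ⁻¹' D i).indicator 1 := rfl
          rw [hD', lintegral_indicator_one (measurable_prodMk_left (hD i)), Kernel.comap_apply]
          by_cases hp : (pairSlice G i (pairProcess p)).1 = (pairSlice G i (pairProcess p)).2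
          · have : pairSlice G i (trunc i (pairProcess p)) =
                (parentSlice G i p.1, parentSlice G i p.1) := by
              rw [pairSlice_trunc hG]
              exact Prod.ext rfl hp.symm
            rw [this]
            exact measure_mono fun s hs => hs.2
          · have : Prod.mk (trunc i (pairProcess p)) ⁻¹' D i = ∅ := by
              ext s
              simp [D, pairSlice_trunc hG, hp]
            simp [this]
      _ = ∫⁻ x, e i (parentSlice G i x) ∂μ := by
          have hem : Measurable fun x : EuclideanSpace ℝ (Fin d) => e i (parentSlice G i x) :=
            (he i).comp (by fun_prop)
          rw [← hπ.1, lintegral_map hem measurable_fst]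
      _ ≤ _ := hbound i
  have hcover : {p : EuclideanSpace ℝ (Fin d) × EuclideanSpace ℝ (Fin d) | p.1 ≠ p.2} ⊆
      ⋃ i, {p | (trunc i (pairProcess p), pairProcess p i) ∈ D i} := by
    intro p hp
    have hex : ∃ i, p.1 i ≠ p.2 i := by
      by_contra! hne
      exact hp (PiLp.ext hne)
    -- At the smallest index of disagreement all parents, being smaller, agree.
    obtain ⟨i, hi, hmin⟩ := WellFounded.has_min wellFounded_lt {i | p.1 i ≠ p.2 i} hex
    refine Set.mem_iUnion.2 ⟨i, ?_, hi⟩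
    rw [pairSlice_trunc hG]
    ext j
    by_contra hj
    exact hmin j.1 hj (hG _ _ j.2)
  calc π {p | p.1 ≠ p.2} ≤ ∑ i, π {p | (trunc i (pairProcess p), pairProcess p i) ∈ D i} :=
        (measure_mono hcover).trans (measure_iUnion_fintype_le _ _)
    _ ≤ ∑ _i : Fin d, 4 * klDiv μ ν ^ (1 / 2 : ℝ) := Finset.sum_le_sum fun i _ => hstep i
    _ = d * (4 * klDiv μ ν ^ (1 / 2 : ℝ)) := by simp

end Estimates

/-! ### From separation probability to transport cost -/

theorem mainTheorem4 (d : ℕ) (K : Set (EuclideanSpace ℝ (Fin d))) (hK : IsCompact K) :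
    ∃ C : ℝ, 0 < C ∧
      ∀ G : Digraph (Fin d), IsSortedDAG G →
      ∀ μ ν : Measure (EuclideanSpace ℝ (Fin d)),
        IsProbabilityMeasure μ → IsProbabilityMeasure ν →
        IsGCompatible G μ → IsGCompatible G ν →
        μ Kᶜ = 0 → ν Kᶜ = 0 →
        causalWasserstein G μ ν ≤
          ENNReal.ofReal C * ((1 / 2 : ℝ≥0∞) * klDiv μ ν) ^ (1 / 2 : ℝ) := by
  obtain ⟨R, hR⟩ := Metric.isBounded_iff.1 hK.isBounded
  -- If `K` is empty, the bound `R` may be negative.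
  let R' : ℝ := max R 0
  have hR' : 0 ≤ R' := le_max_right _ _
  -- The `8` is the `4` of the separation bound times `2`, a crude bound for the `√2` that moves the
  -- factor `1/2` under the root; the `+ 1` only ensures positivity.
  refine ⟨8 * d * R' + 1, by positivity, fun G hG μ ν _ _ hμ hν hμK hνK => ?_⟩
  obtain ⟨π, hπ, hle⟩ := exists_bicausal_measure_ne_le hG hμ hν
  have hoff : MeasurableSet {p : EuclideanSpace ℝ (Fin d) × EuclideanSpace ℝ (Fin d) |
      p.1 ≠ p.2} := (measurableSet_eq_fun measurable_fst measurable_snd).compl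
  have hKm : MeasurableSet Kᶜ := hK.isClosed.measurableSet.compl
  have h1 : ∀ᵐ p ∂π, p.1 ∈ K := by
    have h : π (Prod.fst ⁻¹' Kᶜ) = 0 := by
      rw [← Measure.map_apply measurable_fst hKm, hπ.1, hμK]
    filter_upwards [measure_eq_zero_iff_ae_notMem.1 h] with p hp using by simpa using hp
  have h2 : ∀ᵐ p ∂π, p.2 ∈ K := by
    have h : π (Prod.snd ⁻¹' Kᶜ) = 0 := by
      rw [← Measure.map_apply measurable_snd hKm, hπ.2.1, hνK]
    filter_upwards [measure_eq_zero_iff_ae_notMem.1 h] with p hp using by simpa using hp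
  have hkl : klDiv μ ν ^ (1 / 2 : ℝ) ≤ 2 * ((1 / 2 : ℝ≥0∞) * klDiv μ ν) ^ (1 / 2 : ℝ) := by
    have e : klDiv μ ν = 2 * ((1 / 2 : ℝ≥0∞) * klDiv μ ν) := by
      rw [← mul_assoc, one_div, ENNReal.mul_inv_cancel (by norm_num) (by norm_num), one_mul]
    calc klDiv μ ν ^ (1 / 2 : ℝ) = (2 * ((1 / 2 : ℝ≥0∞) * klDiv μ ν)) ^ (1 / 2 : ℝ) := by rw [← e]
      _ = 2 ^ (1 / 2 : ℝ) * ((1 / 2 : ℝ≥0∞) * klDiv μ ν) ^ (1 / 2 : ℝ) :=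
        ENNReal.mul_rpow_of_nonneg _ _ (by norm_num)
      _ ≤ 2 ^ (1 : ℝ) * ((1 / 2 : ℝ≥0∞) * klDiv μ ν) ^ (1 / 2 : ℝ) := by
        gcongr <;> norm_num
      _ = _ := by rw [ENNReal.rpow_one]
  calc causalWasserstein G μ ν ≤ ∫⁻ p, ‖p.1 - p.2‖ₑ ∂π := iInf₂_le π hπ
    _ ≤ ∫⁻ p, {p : EuclideanSpace ℝ (Fin d) × EuclideanSpace ℝ (Fin d) |
          p.1 ≠ p.2}.indicator (fun _ => ENNReal.ofReal R') p ∂π := by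
        refine lintegral_mono_ae ?_
        filter_upwards [h1, h2] with p hp1 hp2
        by_cases hp : p.1 = p.2
        · simp [hp]
        · rw [Set.indicator_of_mem (by exact hp), ← ofReal_norm, ← dist_eq_norm]
          exact ENNReal.ofReal_le_ofReal ((hR hp1 hp2).trans (le_max_left _ _))
    _ = ENNReal.ofReal R' * π {p | p.1 ≠ p.2} := lintegral_indicator_const hoff _
    _ ≤ ENNReal.ofReal R' *
          (d * (4 * (2 * ((1 / 2 : ℝ≥0∞) * klDiv μ ν) ^ (1 / 2 : ℝ)))) := by
        gcongr
        refine hle.trans ?_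
        gcongr
    _ = ENNReal.ofReal (8 * d * R') * ((1 / 2 : ℝ≥0∞) * klDiv μ ν) ^ (1 / 2 : ℝ) := by
        rw [ENNReal.ofReal_mul (by positivity), ENNReal.ofReal_mul (by norm_num),
          ENNReal.ofReal_natCast, ENNReal.ofReal_ofNat]
        ring
    _ ≤ _ := by
        gcongr
        linarith
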